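/- Let $\mathsf{Q}=\overline{U}_{\mathrm{i}}\,s\ell(2)$ be the restricted quantum group at $\mathfrak q=\mathrm i$: the unital associative $\mathbb{C}$-algebra with generators $E,F,K^{\pm1}$ and relations $KK^{-1}=K^{-1}K=1$, $KEK^{-1}=-E$, $KFK^{-1}=-F$, $EF-FE=\frac{K-K^{-1}}{\mathrm i-\mathrm i^{-1}}$, $E^2=F^2=0$, $K^4=1$, with comultiplication and counit the algebra homomorphisms given by $$\Delta(E)=1\otimes E+E\otimes K,\quad \Delta(F)=K^{-1}\otimes F+F\otimes 1,\quad \Delta(K)=K\otimes K,\qquad \epsilon(E)=\epsilon(F)=0,\ \epsilon(K)=1 .$$ Put $e_0=\tfrac12(1+K^2)$ and $e_1=\tfrac12(1-K^2)$. For $\varepsilon\in\{1,-1\}$ let $\phi_\varepsilon:\mathbb{Z}_2^3\to\mathbb{C}^*$ be given by $\phi_\varepsilon(1,1,1)=\varepsilon$ and $\phi_\varepsilon(i,j,k)=1$ if any of $i,j,k$ is $0$, and let $\Phi_\varepsilon=\sum_{i,j,k\in\mathbb{Z}_2}\phi_\varepsilon(i,j,k)\,e_i\otimes e_j\otimes e_k$.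 A quasi-bialgebra over $\mathbb{C}$ is an algebra $A$ with algebra homomorphisms $\Delta:A\to A\otimes A$, $\epsilon:A\to\mathbb{C}$ and an invertible $\Phi\in A^{\otimes3}$ such that $(\epsilon\otimes\mathrm{id})\Delta=\mathrm{id}=(\mathrm{id}\otimes\epsilon)\Delta$, $(\Delta\otimes\mathrm{id})(\Delta(a))=\Phi\,(\mathrm{id}\otimes\Delta)(\Delta(a))\,\Phi^{-1}$ for all $a\in A$, $(\mathrm{id}\otimes\epsilon\otimes\mathrm{id})(\Phi)=1\otimes1$, and $$(\Delta\otimes\mathrm{id}\otimes\mathrm{id})(\Phi)\,(\mathrm{id}\otimes\mathrm{id}\otimes\Delta)(\Phi)=(\Phi\otimes1)\,(\mathrm{id}\otimes\Delta\otimes\mathrm{id})(\Phi)\,(1\otimes\Phi).$$ It is quasi-triangular if it admits a universal R-matrix, that is, an invertible $R\in A\otimes A$ with $R\,\Delta(a)=\Delta^{\mathrm{op}}(a)\,R$ for all $a\in A$ and $$(\Delta\otimes\mathrm{id})(R)=\Phi_{231}^{-1}R_{13}\Phi_{132}R_{23}\Phi^{-1},\qquad(\mathrm{id}\otimes\Delta)(R)=\Phi_{312}R_{13}\Phi_{213}^{-1}R_{12}\Phi,$$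 where for $\Phi=\sum\Phi'\otimes\Phi''\otimes\Phi'''$ one writes $\Phi_{231}=\sum\Phi''\otimes\Phi'''\otimes\Phi'$, etc., and for $R=\sum R_1\otimes R_2$ one writes $R_{13}=\sum R_1\otimes1\otimes R_2$, etc. **Theorem.** For both $\varepsilon=1$ and $\varepsilon=-1$, $\phi_\varepsilon$ is a normalised $3$-cocycle of the group $\mathbb{Z}_2$ with values in $\mathbb{C}^*$, $\Phi_\varepsilon=1\otimes1\otimes1+(\varepsilon-1)\,e_1\otimes e_1\otimes e_1$, and $(\mathsf{Q},\Delta,\epsilon,\Phi_\varepsilon)$ is a quasi-bialgebra which is not quasi-triangular. In particular (case $\varepsilon=1$), the bialgebra $\mathsf{Q}$ has no universal R-matrix: there is no invertible $R\in\mathsf{Q}\otimes\mathsf{Q}$ with $R\,\Delta(a)=\Delta^{\mathrm{op}}(a)\,R$ for all $a\in\mathsf{Q}$, $(\Delta\otimes\mathrm{id})(R)=R_{13}R_{23}$ and $(\mathrm{id}\otimes\Delta)(R)=R_{13}R_{12}$. Moreover, the monoidal category of finite-dimensional complex representations of $\mathsf{Q}$, with the tensor product given by $\Delta$, the unit object $\mathbb{C}$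 given by $\epsilon$, and the associativity and unit isomorphisms of vector spaces, admits no braiding. -/

import Mathlib

open scoped TensorProduct
open CategoryTheory

noncomputable section

/-! ### Quasi-bialgebras and universal R-matrices over `ℂ` -/

namespace QB

variable {A : Type} [Ring A] [Algebra ℂ A]

/-- `Δ ⊗ id : A ⊗ A → A ⊗ A ⊗ A`; triple tensor products are bracketed to the right. -/
def comulLeft (Δ : A →ₐ[ℂ] A ⊗[ℂ] A) : A ⊗[ℂ] A →ₐ[ℂ] A ⊗[ℂ] (A ⊗[ℂ] A) :=
  (Algebra.TensorProduct.assoc ℂ ℂ ℂ A A A).toAlgHom.comp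
    (Algebra.TensorProduct.map Δ (AlgHom.id ℂ A))

/-- `id ⊗ Δ : A ⊗ A → A ⊗ A ⊗ A`. -/
def comulRight (Δ : A →ₐ[ℂ] A ⊗[ℂ] A) : A ⊗[ℂ] A →ₐ[ℂ] A ⊗[ℂ] (A ⊗[ℂ] A) :=
  Algebra.TensorProduct.map (AlgHom.id ℂ A) Δ

/-- `Δ ⊗ id ⊗ id : A ⊗ A ⊗ A → A ⊗ A ⊗ A ⊗ A`. -/
def comul₁ (Δ : A →ₐ[ℂ] A ⊗[ℂ] A) :
    A ⊗[ℂ] (A ⊗[ℂ] A) →ₐ[ℂ] A ⊗[ℂ] (A ⊗[ℂ] (A ⊗[ℂ] A)) :=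
  (Algebra.TensorProduct.assoc ℂ ℂ ℂ A A (A ⊗[ℂ] A)).toAlgHom.comp
    (Algebra.TensorProduct.map Δ (AlgHom.id ℂ (A ⊗[ℂ] A)))

/-- `id ⊗ Δ ⊗ id : A ⊗ A ⊗ A → A ⊗ A ⊗ A ⊗ A`. -/
def comul₂ (Δ : A →ₐ[ℂ] A ⊗[ℂ] A) :
    A ⊗[ℂ] (A ⊗[ℂ] A) →ₐ[ℂ] A ⊗[ℂ] (A ⊗[ℂ] (A ⊗[ℂ] A)) :=
  Algebra.TensorProduct.map (AlgHom.id ℂ A) (comulLeft Δ)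

/-- `id ⊗ id ⊗ Δ : A ⊗ A ⊗ A → A ⊗ A ⊗ A ⊗ A`. -/
def comul₃ (Δ : A →ₐ[ℂ] A ⊗[ℂ] A) :
    A ⊗[ℂ] (A ⊗[ℂ] A) →ₐ[ℂ] A ⊗[ℂ] (A ⊗[ℂ] (A ⊗[ℂ] A)) :=
  Algebra.TensorProduct.map (AlgHom.id ℂ A) (comulRight Δ)

/-- `x ↦ x ⊗ 1` from triple to fourfold tensors. -/
def tensorOne : A ⊗[ℂ] (A ⊗[ℂ] A) →ₐ[ℂ] A ⊗[ℂ] (A ⊗[ℂ] (A ⊗[ℂ] A)) :=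
  Algebra.TensorProduct.map (AlgHom.id ℂ A)
    (Algebra.TensorProduct.map (AlgHom.id ℂ A) Algebra.TensorProduct.includeLeft)

/-- `x ↦ 1 ⊗ x` from triple to fourfold tensors. -/
def oneTensor : A ⊗[ℂ] (A ⊗[ℂ] A) →ₐ[ℂ] A ⊗[ℂ] (A ⊗[ℂ] (A ⊗[ℂ] A)) :=
  Algebra.TensorProduct.includeRight

/-- `ϵ ⊗ id : A ⊗ A → A`. -/
def counitLeft (ϵ : A →ₐ[ℂ] ℂ) : A ⊗[ℂ] A →ₐ[ℂ] A :=
  (Algebra.TensorProduct.lid ℂ A).toAlgHom.comp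
    (Algebra.TensorProduct.map ϵ (AlgHom.id ℂ A))

/-- `id ⊗ ϵ : A ⊗ A → A`. -/
def counitRight (ϵ : A →ₐ[ℂ] ℂ) : A ⊗[ℂ] A →ₐ[ℂ] A :=
  (Algebra.TensorProduct.rid ℂ ℂ A).toAlgHom.comp
    (Algebra.TensorProduct.map (AlgHom.id ℂ A) ϵ)

/-- `id ⊗ ϵ ⊗ id : A ⊗ A ⊗ A → A ⊗ A`. -/
def counitMiddle (ϵ : A →ₐ[ℂ] ℂ) : A ⊗[ℂ] (A ⊗[ℂ] A) →ₐ[ℂ] A ⊗[ℂ] A :=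
  Algebra.TensorProduct.map (AlgHom.id ℂ A) (counitLeft ϵ)

/-- `a ⊗ b ⊗ c ↦ a ⊗ c ⊗ b`, i.e. `x ↦ x₁₃₂`. -/
def perm132 : A ⊗[ℂ] (A ⊗[ℂ] A) →ₐ[ℂ] A ⊗[ℂ] (A ⊗[ℂ] A) :=
  Algebra.TensorProduct.map (AlgHom.id ℂ A) (Algebra.TensorProduct.comm ℂ A A).toAlgHom

/-- `a ⊗ b ⊗ c ↦ b ⊗ a ⊗ c`, i.e. `x ↦ x₂₁₃`. -/
def perm213 : A ⊗[ℂ] (A ⊗[ℂ] A) →ₐ[ℂ] A ⊗[ℂ] (A ⊗[ℂ] A) :=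
  (Algebra.TensorProduct.leftComm ℂ A A A).toAlgHom

/-- `a ⊗ b ⊗ c ↦ b ⊗ c ⊗ a`, i.e. `x ↦ x₂₃₁`. -/
def perm231 : A ⊗[ℂ] (A ⊗[ℂ] A) →ₐ[ℂ] A ⊗[ℂ] (A ⊗[ℂ] A) :=
  perm132.comp perm213

/-- `a ⊗ b ⊗ c ↦ c ⊗ a ⊗ b`, i.e. `x ↦ x₃₁₂`. -/
def perm312 : A ⊗[ℂ] (A ⊗[ℂ] A) →ₐ[ℂ] A ⊗[ℂ] (A ⊗[ℂ] A) :=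
  perm213.comp perm132

/-- `r ⊗ s ↦ 1 ⊗ r ⊗ s`, i.e. `R ↦ R₂₃`. -/
def emb23 : A ⊗[ℂ] A →ₐ[ℂ] A ⊗[ℂ] (A ⊗[ℂ] A) :=
  Algebra.TensorProduct.includeRight

/-- `r ⊗ s ↦ r ⊗ 1 ⊗ s`, i.e. `R ↦ R₁₃`. -/
def emb13 : A ⊗[ℂ] A →ₐ[ℂ] A ⊗[ℂ] (A ⊗[ℂ] A) :=
  Algebra.TensorProduct.map (AlgHom.id ℂ A) Algebra.TensorProduct.includeRight

/-- `r ⊗ s ↦ r ⊗ s ⊗ 1`, i.e. `R ↦ R₁₂`. -/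
def emb12 : A ⊗[ℂ] A →ₐ[ℂ] A ⊗[ℂ] (A ⊗[ℂ] A) :=
  Algebra.TensorProduct.map (AlgHom.id ℂ A) Algebra.TensorProduct.includeLeft

/-- `(A, Δ, ϵ, Φ)` is a quasi-bialgebra. The inverse of the invertible element `Φ` is
`Ring.inverse Φ`. -/
structure IsQuasiBialgebra (Δ : A →ₐ[ℂ] A ⊗[ℂ] A) (ϵ : A →ₐ[ℂ] ℂ)
    (Φ : A ⊗[ℂ] (A ⊗[ℂ] A)) : Prop where
  isUnit : IsUnit Φ
  counit_left : ∀ a, counitLeft ϵ (Δ a) = a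
  counit_right : ∀ a, counitRight ϵ (Δ a) = a
  quasi_coassoc : ∀ a,
    comulLeft Δ (Δ a) = Φ * comulRight Δ (Δ a) * Ring.inverse Φ
  counital : counitMiddle ϵ Φ = 1 ⊗ₜ[ℂ] 1
  cocycle : comul₁ Δ Φ * comul₃ Δ Φ = tensorOne Φ * comul₂ Δ Φ * oneTensor Φ

/-- `R` is a universal R-matrix for the quasi-bialgebra with comultiplication `Δ` and
coassociator `Φ`. -/
structure IsUniversalRMatrix (Δ : A →ₐ[ℂ] A ⊗[ℂ] A)
    (Φ : A ⊗[ℂ] (A ⊗[ℂ] A)) (R : A ⊗[ℂ] A) : Prop where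
  isUnit : IsUnit R
  intertwine : ∀ a, R * Δ a = Algebra.TensorProduct.comm ℂ A A (Δ a) * R
  hexagon_left : comulLeft Δ R =
    Ring.inverse (perm231 Φ) * emb13 R * perm132 Φ * emb23 R * Ring.inverse Φ
  hexagon_right : comulRight Δ R =
    perm312 Φ * emb13 R * Ring.inverse (perm213 Φ) * emb12 R * Φ

/-- `(A, Δ, Φ)` is quasi-triangular: it admits a universal R-matrix. -/
def IsQuasiTriangular (Δ : A →ₐ[ℂ] A ⊗[ℂ] A) (Φ : A ⊗[ℂ] (A ⊗[ℂ] A)) : Prop :=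
  ∃ R, IsUniversalRMatrix Δ Φ R

/-- `R` is a universal R-matrix for the (strictly coassociative) bialgebra with
comultiplication `Δ`. -/
structure IsBialgebraRMatrix (Δ : A →ₐ[ℂ] A ⊗[ℂ] A) (R : A ⊗[ℂ] A) : Prop where
  isUnit : IsUnit R
  intertwine : ∀ a, R * Δ a = Algebra.TensorProduct.comm ℂ A A (Δ a) * R
  hexagon_left : comulLeft Δ R = emb13 R * emb23 R
  hexagon_right : comulRight Δ R = emb13 R * emb12 R

end QB

/-! ### The restricted quantum group `Q` of `sl(2)` at `q = i` -/

namespace ResQ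

/-- The generators `E`, `F`, `K`, `K⁻¹`. -/
inductive Gen : Type
  | E | F | K | Kinv

open FreeAlgebra in
/-- The defining relations at `q = i`. -/
inductive Rel : FreeAlgebra ℂ Gen → FreeAlgebra ℂ Gen → Prop
  | K_Kinv : Rel (ι ℂ Gen.K * ι ℂ Gen.Kinv) 1
  | Kinv_K : Rel (ι ℂ Gen.Kinv * ι ℂ Gen.K) 1
  | K_E : Rel (ι ℂ Gen.K * ι ℂ Gen.E * ι ℂ Gen.Kinv) (-ι ℂ Gen.E)
  | K_F : Rel (ι ℂ Gen.K * ι ℂ Gen.F * ι ℂ Gen.Kinv) (-ι ℂ Gen.F)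
  | E_F : Rel (ι ℂ Gen.E * ι ℂ Gen.F - ι ℂ Gen.F * ι ℂ Gen.E)
      ((Complex.I - Complex.I⁻¹)⁻¹ • (ι ℂ Gen.K - ι ℂ Gen.Kinv))
  | E_sq : Rel (ι ℂ Gen.E ^ 2) 0
  | F_sq : Rel (ι ℂ Gen.F ^ 2) 0
  | K_pow : Rel (ι ℂ Gen.K ^ 4) 1

/-- The algebra `Q` generated by `E`, `F`, `K`, `K⁻¹` subject to the relations `Rel`. -/
def Q : Type := RingQuot Rel

instance instRingQ : Ring Q := inferInstanceAs (Ring (RingQuot Rel))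

instance instAlgebraQ : Algebra ℂ Q := inferInstanceAs (Algebra ℂ (RingQuot Rel))

/-- The quotient map from the free algebra. -/
def toQ : FreeAlgebra ℂ Gen →ₐ[ℂ] Q := RingQuot.mkAlgHom ℂ Rel

theorem toQ_rel {x y : FreeAlgebra ℂ Gen} (h : Rel x y) : toQ x = toQ y :=
  RingQuot.mkAlgHom_rel ℂ h

/-- The class of a generator in `Q`. -/
def gen (g : Gen) : Q := toQ (FreeAlgebra.ι ℂ g)

def E : Q := gen Gen.E
def F : Q := gen Gen.F
def K : Q := gen Gen.K
def Kinv : Q := gen Gen.Kinv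

/-- The images `e, f, k, k'` of the generators satisfy the defining relations. -/
structure Sat {B : Type} [Ring B] [Algebra ℂ B] (e f k k' : B) : Prop where
  k_k' : k * k' = 1
  k'_k : k' * k = 1
  k_e : k * e * k' = -e
  k_f : k * f * k' = -f
  e_f : e * f - f * e = (Complex.I - Complex.I⁻¹)⁻¹ • (k - k')
  e_sq : e ^ 2 = 0
  f_sq : f ^ 2 = 0
  k_pow : k ^ 4 = 1

theorem sat_gen : Sat E F K Kinv where
  k_k' := by
    have h := toQ_rel Rel.K_Kinv
    simp only [map_mul, map_one] at h
    exact h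
  k'_k := by
    have h := toQ_rel Rel.Kinv_K
    simp only [map_mul, map_one] at h
    exact h
  k_e := by
    have h := toQ_rel Rel.K_E
    simp only [map_mul, map_neg] at h
    exact h
  k_f := by
    have h := toQ_rel Rel.K_F
    simp only [map_mul, map_neg] at h
    exact h
  e_f := by
    have h := toQ_rel Rel.E_F
    simp only [map_mul, map_sub, map_smul] at h
    exact h
  e_sq := by
    have h := toQ_rel Rel.E_sq
    simp only [map_pow, map_zero] at h
    exact h
  f_sq := by
    have h := toQ_rel Rel.F_sq
    simp only [map_pow, map_zero] at h
    exact h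
  k_pow := by
    have h := toQ_rel Rel.K_pow
    simp only [map_pow, map_one] at h
    exact h

/-- A choice of images of the generators. -/
def genMap {B : Type} (e f k k' : B) : Gen → B
  | Gen.E => e
  | Gen.F => f
  | Gen.K => k
  | Gen.Kinv => k'

theorem lift_aux {B : Type} [Ring B] [Algebra ℂ B] {e f k k' : B} (h : Sat e f k k')
    ⦃x y : FreeAlgebra ℂ Gen⦄ (hxy : Rel x y) :
    FreeAlgebra.lift ℂ (genMap e f k k') x = FreeAlgebra.lift ℂ (genMap e f k k') y := by
  cases hxy <;> simp only [map_mul, map_sub, map_neg, map_pow, map_one, map_zero, map_smul,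
    FreeAlgebra.lift_ι_apply, genMap]
  exacts [h.k_k', h.k'_k, h.k_e, h.k_f, h.e_f, h.e_sq, h.f_sq, h.k_pow]

/-- The algebra homomorphism out of `Q` with prescribed images of the generators. -/
def lift {B : Type} [Ring B] [Algebra ℂ B] {e f k k' : B} (h : Sat e f k k') : Q →ₐ[ℂ] B :=
  RingQuot.liftAlgHom ℂ ⟨FreeAlgebra.lift ℂ (genMap e f k k'), lift_aux h⟩

section lift

variable {B : Type} [Ring B] [Algebra ℂ B] {e f k k' : B} (h : Sat e f k k')

theorem lift_gen (g : Gen) : lift h (gen g) = genMap e f k k' g := by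
  have := RingQuot.liftAlgHom_mkAlgHom_apply ℂ (FreeAlgebra.lift ℂ (genMap e f k k'))
    (lift_aux h) (FreeAlgebra.ι ℂ g)
  rw [FreeAlgebra.lift_ι_apply] at this
  exact this

@[simp] theorem lift_E : lift h E = e := lift_gen h _
@[simp] theorem lift_F : lift h F = f := lift_gen h _
@[simp] theorem lift_K : lift h K = k := lift_gen h _
@[simp] theorem lift_Kinv : lift h Kinv = k' := lift_gen h _

theorem hom_ext {φ ψ : Q →ₐ[ℂ] B} (hE : φ E = ψ E) (hF : φ F = ψ F) (hK : φ K = ψ K)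
    (hKinv : φ Kinv = ψ Kinv) : φ = ψ := by
  refine RingQuot.ringQuot_ext' ℂ φ ψ (FreeAlgebra.hom_ext (funext fun g => ?_))
  cases g
  exacts [hE, hF, hK, hKinv]

end lift

theorem K_mul_E : K * E = -(E * K) := by
  have h := congrArg (· * K) sat_gen.k_e
  simpa [mul_assoc, sat_gen.k'_k] using h

theorem K_mul_F : K * F = -(F * K) := by
  have h := congrArg (· * K) sat_gen.k_f
  simpa [mul_assoc, sat_gen.k'_k] using h

theorem Kinv_mul_E : Kinv * E = -(E * Kinv) := by
  have h := congrArg (Kinv * ·) sat_gen.k_e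
  simp only [← mul_assoc, sat_gen.k'_k, one_mul] at h
  simp [h]

theorem Kinv_mul_F : Kinv * F = -(F * Kinv) := by
  have h := congrArg (Kinv * ·) sat_gen.k_f
  simp only [← mul_assoc, sat_gen.k'_k, one_mul] at h
  simp [h]

theorem sat_comul : Sat (1 ⊗ₜ[ℂ] E + E ⊗ₜ[ℂ] K) (Kinv ⊗ₜ[ℂ] F + F ⊗ₜ[ℂ] 1)
    (K ⊗ₜ[ℂ] K) (Kinv ⊗ₜ[ℂ] Kinv) := by
  have hEE : E * E = 0 := by simpa [sq] using sat_gen.e_sq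
  have hFF : F * F = 0 := by simpa [sq] using sat_gen.f_sq
  have hEF : E * F = F * E + (Complex.I - Complex.I⁻¹)⁻¹ • (K - Kinv) := by
    rw [← sat_gen.e_f]; abel
  constructor
  · simp [sat_gen.k_k', Algebra.TensorProduct.one_def]
  · simp [sat_gen.k'_k, Algebra.TensorProduct.one_def]
  · simp [mul_add, add_mul, sat_gen.k_k', sat_gen.k_e, mul_assoc K K Kinv, TensorProduct.tmul_neg,
      TensorProduct.neg_tmul]
    abel
  · simp [mul_add, add_mul, sat_gen.k_k', sat_gen.k_f, TensorProduct.tmul_neg,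
      TensorProduct.neg_tmul]
    abel
  · simp only [mul_add, add_mul, Algebra.TensorProduct.tmul_mul_tmul, one_mul, mul_one,
      K_mul_F, Kinv_mul_E, hEF, TensorProduct.tmul_add, TensorProduct.add_tmul,
      TensorProduct.tmul_neg, TensorProduct.neg_tmul, TensorProduct.tmul_smul,
      TensorProduct.smul_tmul', TensorProduct.tmul_sub, TensorProduct.sub_tmul, smul_sub]
    abel
  · simp [sq, mul_add, add_mul, hEE, K_mul_E, TensorProduct.tmul_neg]
  · simp [sq, mul_add, add_mul, hFF, Kinv_mul_F, TensorProduct.neg_tmul]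
  · simp [Algebra.TensorProduct.tmul_pow, sat_gen.k_pow, Algebra.TensorProduct.one_def]

theorem sat_counit : Sat (0 : ℂ) 0 1 1 := by
  constructor <;> simp

/-- The comultiplication: `Δ E = 1 ⊗ E + E ⊗ K`, `Δ F = K⁻¹ ⊗ F + F ⊗ 1`, `Δ K = K ⊗ K`. -/
def comul : Q →ₐ[ℂ] Q ⊗[ℂ] Q := lift sat_comul

/-- The counit: `ϵ E = ϵ F = 0`, `ϵ K = 1`. -/
def counit : Q →ₐ[ℂ] ℂ := lift sat_counit

instance instBialgebraQ : Bialgebra ℂ Q :=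
  Bialgebra.ofAlgHom comul counit
    (by
      apply hom_ext <;>
        simp [comul, TensorProduct.tmul_add, TensorProduct.add_tmul,
          Algebra.TensorProduct.one_def, add_assoc])
    (by
      apply hom_ext <;>
        simp [comul, counit])
    (by
      apply hom_ext <;>
        simp [comul, counit])

/-- The central idempotents `e₀ = (1 + K²)/2` and `e₁ = (1 - K²)/2`. -/
def e (i : ZMod 2) : Q := if i = 0 then (2⁻¹ : ℂ) • (1 + K ^ 2) else (2⁻¹ : ℂ) • (1 - K ^ 2)

/-- `φ_ε(i,j,k)` equals `ε` if `i = j = k = 1`, and `1` otherwise. -/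
def phi (ε : ℂˣ) (i j k : ZMod 2) : ℂˣ := if i = 1 ∧ j = 1 ∧ k = 1 then ε else 1

/-- `ω` is a normalised `3`-cocycle of `ℤ/2` with values in `ℂˣ` (trivial action). -/
structure IsNormalisedThreeCocycle (ω : ZMod 2 → ZMod 2 → ZMod 2 → ℂˣ) : Prop where
  cocycle : ∀ i j k l,
    ω j k l * ω i (j + k) l * ω i j k = ω (i + j) k l * ω i j (k + l)
  normalised : ∀ i j k, i = 0 ∨ j = 0 ∨ k = 0 → ω i j k = 1

/-- `Φ_ε = ∑ φ_ε(i,j,k) e_i ⊗ e_j ⊗ e_k`. -/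
def Phi (ε : ℂˣ) : Q ⊗[ℂ] (Q ⊗[ℂ] Q) :=
  ∑ i : ZMod 2, ∑ j : ZMod 2, ∑ k : ZMod 2,
    (phi ε i j k : ℂ) • (e i ⊗ₜ[ℂ] (e j ⊗ₜ[ℂ] e k))

end ResQ

/-! ### The monoidal category of finite-dimensional modules over a bialgebra -/

/-- A finite-dimensional complex representation of the algebra `A`. -/
structure FinRep (A : Type) [Ring A] [Algebra ℂ A] where
  V : Type
  [addCommGroup : AddCommGroup V]
  [module : Module ℂ V]
  [finite : FiniteDimensional ℂ V]
  ρ : A →ₐ[ℂ] Module.End ℂ V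

namespace FinRep

attribute [instance] FinRep.addCommGroup FinRep.module FinRep.finite

section Category

variable {A : Type} [Ring A] [Algebra ℂ A]

/-- Intertwiners. -/
@[ext] structure Hom (X Y : FinRep A) where
  map : X.V →ₗ[ℂ] Y.V
  comm : ∀ a x, map (X.ρ a x) = Y.ρ a (map x)

instance : Category (FinRep A) where
  Hom X Y := Hom X Y
  id X := ⟨LinearMap.id, fun _ _ => rfl⟩
  comp f g := ⟨g.map ∘ₗ f.map, fun a x => by simp [f.comm, g.comm]⟩

@[ext] theorem hom_ext {X Y : FinRep A} {f g : X ⟶ Y} (h : f.map = g.map) : f = g :=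
  Hom.ext h

@[simp] theorem id_map (X : FinRep A) : (𝟙 X : X ⟶ X).map = LinearMap.id := rfl

@[simp] theorem comp_map {X Y Z : FinRep A} (f : X ⟶ Y) (g : Y ⟶ Z) :
    (f ≫ g).map = g.map ∘ₗ f.map := rfl

/-- A linear equivalence that intertwines the actions is an isomorphism. -/
def mkIso {X Y : FinRep A} (f : X.V ≃ₗ[ℂ] Y.V) (h : ∀ a x, f (X.ρ a x) = Y.ρ a (f x)) :
    X ≅ Y where
  hom := ⟨f.toLinearMap, h⟩
  inv := ⟨f.symm.toLinearMap, fun a y => by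
    apply f.injective
    simp [h]⟩
  hom_inv_id := by ext x; exact f.symm_apply_apply x
  inv_hom_id := by ext x; exact f.apply_symm_apply x

end Category

/-- The action of `A ⊗ B` on `V ⊗ W` for an `A`-module `V` and a `B`-module `W`. -/
def act {A B V W : Type} [Ring A] [Algebra ℂ A] [Ring B] [Algebra ℂ B] [AddCommGroup V]
    [Module ℂ V] [AddCommGroup W] [Module ℂ W] (ρ : A →ₐ[ℂ] Module.End ℂ V)
    (σ : B →ₐ[ℂ] Module.End ℂ W) : A ⊗[ℂ] B →ₐ[ℂ] Module.End ℂ (V ⊗[ℂ] W) :=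
  Module.endTensorEndAlgHom.comp (Algebra.TensorProduct.map ρ σ)

section act

variable {A B C V W U : Type} [Ring A] [Algebra ℂ A] [Ring B] [Algebra ℂ B] [Ring C]
  [Algebra ℂ C] [AddCommGroup V] [Module ℂ V] [AddCommGroup W] [Module ℂ W]
  [AddCommGroup U] [Module ℂ U] (ρ : A →ₐ[ℂ] Module.End ℂ V)
  (σ : B →ₐ[ℂ] Module.End ℂ W) (τ : C →ₐ[ℂ] Module.End ℂ U)

@[simp] theorem act_tmul (a : A) (b : B) (v : V) (w : W) :
    act ρ σ (a ⊗ₜ b) (v ⊗ₜ w) = ρ a v ⊗ₜ σ b w := by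
  simp [act, Module.endTensorEndAlgHom_apply]

theorem act_comp {A' B' : Type} [Ring A'] [Algebra ℂ A'] [Ring B'] [Algebra ℂ B']
    (f : A' →ₐ[ℂ] A) (g : B' →ₐ[ℂ] B) (t : A' ⊗[ℂ] B') :
    act (ρ.comp f) (σ.comp g) t = act ρ σ (Algebra.TensorProduct.map f g t) := by
  induction t with
  | zero => simp
  | add s t hs ht => simp only [map_add, hs, ht]
  | tmul a b =>
    apply TensorProduct.ext'
    intro v w
    simp

theorem assoc_act (u : (A ⊗[ℂ] B) ⊗[ℂ] C) (x : (V ⊗[ℂ] W) ⊗[ℂ] U) :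
    TensorProduct.assoc ℂ V W U (act (act ρ σ) τ u x) =
      act ρ (act σ τ) (Algebra.TensorProduct.assoc ℂ ℂ ℂ A B C u)
        (TensorProduct.assoc ℂ V W U x) := by
  refine LinearMap.congr_fun
    (f := (TensorProduct.assoc ℂ V W U).toLinearMap ∘ₗ act (act ρ σ) τ u)
    (g := act ρ (act σ τ) (Algebra.TensorProduct.assoc ℂ ℂ ℂ A B C u) ∘ₗ
      (TensorProduct.assoc ℂ V W U).toLinearMap) ?_ x
  induction u with
  | zero => simp
  | add s t hs ht => simp only [map_add, LinearMap.comp_add, LinearMap.add_comp, hs, ht]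
  | tmul t c =>
    induction t with
    | zero => simp
    | add s t hs ht =>
      simp only [TensorProduct.add_tmul, map_add, LinearMap.comp_add, LinearMap.add_comp, hs, ht]
    | tmul a b =>
      apply TensorProduct.ext_threefold
      intro x y z
      simp

theorem lid_act (ϵ : A →ₐ[ℂ] ℂ) (t : A ⊗[ℂ] B) (x : ℂ ⊗[ℂ] W) :
    TensorProduct.lid ℂ W (act ((Algebra.lmul ℂ ℂ).comp ϵ) σ t x) =
      σ (TensorProduct.lid ℂ B (LinearMap.rTensor B ϵ.toLinearMap t))
        (TensorProduct.lid ℂ W x) := by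
  refine LinearMap.congr_fun
    (f := (TensorProduct.lid ℂ W).toLinearMap ∘ₗ act ((Algebra.lmul ℂ ℂ).comp ϵ) σ t)
    (g := σ (TensorProduct.lid ℂ B (LinearMap.rTensor B ϵ.toLinearMap t)) ∘ₗ
      (TensorProduct.lid ℂ W).toLinearMap) ?_ x
  induction t with
  | zero => simp
  | add s t hs ht => simp only [map_add, LinearMap.comp_add, LinearMap.add_comp, hs, ht]
  | tmul b c =>
    apply TensorProduct.ext'
    intro z x
    simp [mul_smul]

theorem rid_act (ϵ : B →ₐ[ℂ] ℂ) (t : A ⊗[ℂ] B) (x : V ⊗[ℂ] ℂ) :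
    TensorProduct.rid ℂ V (act ρ ((Algebra.lmul ℂ ℂ).comp ϵ) t x) =
      ρ (TensorProduct.rid ℂ A (LinearMap.lTensor A ϵ.toLinearMap t))
        (TensorProduct.rid ℂ V x) := by
  refine LinearMap.congr_fun
    (f := (TensorProduct.rid ℂ V).toLinearMap ∘ₗ act ρ ((Algebra.lmul ℂ ℂ).comp ϵ) t)
    (g := ρ (TensorProduct.rid ℂ A (LinearMap.lTensor A ϵ.toLinearMap t)) ∘ₗ
      (TensorProduct.rid ℂ V).toLinearMap) ?_ x
  induction t with
  | zero => simp
  | add s t hs ht => simp only [map_add, LinearMap.comp_add, LinearMap.add_comp, hs, ht]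
  | tmul b c =>
    apply TensorProduct.ext'
    intro x z
    simp [mul_smul]

theorem map_act {V' W' : Type} [AddCommGroup V'] [Module ℂ V'] [AddCommGroup W'] [Module ℂ W']
    (ρ' : A →ₐ[ℂ] Module.End ℂ V') (σ' : B →ₐ[ℂ] Module.End ℂ W') (f : V →ₗ[ℂ] V')
    (g : W →ₗ[ℂ] W') (hf : ∀ a v, f (ρ a v) = ρ' a (f v)) (hg : ∀ b w, g (σ b w) = σ' b (g w))
    (t : A ⊗[ℂ] B) (x : V ⊗[ℂ] W) :
    TensorProduct.map f g (act ρ σ t x) = act ρ' σ' t (TensorProduct.map f g x) := by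
  refine LinearMap.congr_fun (f := TensorProduct.map f g ∘ₗ act ρ σ t)
    (g := act ρ' σ' t ∘ₗ TensorProduct.map f g) ?_ x
  induction t with
  | zero => simp
  | add s t hs ht => simp only [map_add, LinearMap.comp_add, LinearMap.add_comp, hs, ht]
  | tmul b c =>
    apply TensorProduct.ext'
    intro x y
    simp [hf, hg]

theorem triangle_act (v : V) (z : ℂ) (w : W) :
    v ⊗ₜ[ℂ] (z • w) = (z • v) ⊗ₜ[ℂ] w := (TensorProduct.smul_tmul z v w).symm

end act

section Monoidal

variable {A : Type} [Ring A] [Bialgebra ℂ A]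

/-- `U ⊗ V` over `ℂ`, on which `a` acts through `Δ a`. -/
def tensor (X Y : FinRep A) : FinRep A where
  V := X.V ⊗[ℂ] Y.V
  ρ := (act X.ρ Y.ρ).comp (Bialgebra.comulAlgHom ℂ A)

/-- The ground field, on which `A` acts through the counit. -/
def unit : FinRep A where
  V := ℂ
  ρ := (Algebra.lmul ℂ ℂ).comp (Bialgebra.counitAlgHom ℂ A)

theorem unit_ρ (a : A) (z : ℂ) :
    (unit : FinRep A).ρ a z = Coalgebra.counit (R := ℂ) a * z := rfl

theorem tensor_ρ (X Y : FinRep A) (a : A) :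
    (tensor X Y).ρ a = act X.ρ Y.ρ (Coalgebra.comul (R := ℂ) a) := rfl

/-- The tensor product of two intertwiners. -/
def tensorMap {X X' Y Y' : FinRep A} (f : X ⟶ X') (g : Y ⟶ Y') :
    tensor X Y ⟶ tensor X' Y' :=
  ⟨TensorProduct.map f.map g.map, fun a =>
    map_act X.ρ Y.ρ X'.ρ Y'.ρ f.map g.map f.comm g.comm (Coalgebra.comul (R := ℂ) a)⟩

theorem tensorMap_map {X X' Y Y' : FinRep A} (f : X ⟶ X') (g : Y ⟶ Y') :
    (tensorMap f g).map = TensorProduct.map f.map g.map := rfl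

theorem assoc_comm (X Y Z : FinRep A) (a : A) (x : (X.V ⊗[ℂ] Y.V) ⊗[ℂ] Z.V) :
    TensorProduct.assoc ℂ X.V Y.V Z.V ((tensor (tensor X Y) Z).ρ a x) =
      (tensor X (tensor Y Z)).ρ a (TensorProduct.assoc ℂ X.V Y.V Z.V x) := by
  have h1 := act_comp (act X.ρ Y.ρ) Z.ρ (Bialgebra.comulAlgHom ℂ A) (AlgHom.id ℂ A)
    (Coalgebra.comul (R := ℂ) a)
  have h2 := act_comp X.ρ (act Y.ρ Z.ρ) (AlgHom.id ℂ A) (Bialgebra.comulAlgHom ℂ A)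
    (Coalgebra.comul (R := ℂ) a)
  have h3 : Algebra.TensorProduct.assoc ℂ ℂ ℂ A A A
      (Algebra.TensorProduct.map (Bialgebra.comulAlgHom ℂ A) (AlgHom.id ℂ A)
          (Coalgebra.comul (R := ℂ) a)) =
      Algebra.TensorProduct.map (AlgHom.id ℂ A) (Bialgebra.comulAlgHom ℂ A)
          (Coalgebra.comul (R := ℂ) a) := Coalgebra.coassoc_apply a
  have h4 := assoc_act X.ρ Y.ρ Z.ρ (Algebra.TensorProduct.map (Bialgebra.comulAlgHom ℂ A)
    (AlgHom.id ℂ A) (Coalgebra.comul (R := ℂ) a)) x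
  rw [h3, ← h1, ← h2] at h4
  exact h4

theorem lid_comm (X : FinRep A) (a : A) (x : ℂ ⊗[ℂ] X.V) :
    TensorProduct.lid ℂ X.V ((tensor unit X).ρ a x) = X.ρ a (TensorProduct.lid ℂ X.V x) := by
  refine (lid_act X.ρ (Bialgebra.counitAlgHom ℂ A) (Coalgebra.comul (R := ℂ) a) x).trans ?_
  have h := Coalgebra.rTensor_counit_comul (R := ℂ) a
  change X.ρ (TensorProduct.lid ℂ A (LinearMap.rTensor A Coalgebra.counit
    (Coalgebra.comul (R := ℂ) a))) _ = _
  rw [h, TensorProduct.lid_tmul, one_smul]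

theorem rid_comm (X : FinRep A) (a : A) (x : X.V ⊗[ℂ] ℂ) :
    TensorProduct.rid ℂ X.V ((tensor X unit).ρ a x) = X.ρ a (TensorProduct.rid ℂ X.V x) := by
  refine (rid_act X.ρ (Bialgebra.counitAlgHom ℂ A) (Coalgebra.comul (R := ℂ) a) x).trans ?_
  have h := Coalgebra.lTensor_counit_comul (R := ℂ) a
  change X.ρ (TensorProduct.rid ℂ A (LinearMap.lTensor A Coalgebra.counit
    (Coalgebra.comul (R := ℂ) a))) _ = _
  rw [h, TensorProduct.rid_tmul, one_smul]

/-- The tensor category of finite-dimensional representations, with the associativity and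
unit isomorphisms of vector spaces. -/
instance instMonoidalStruct : MonoidalCategoryStruct (FinRep A) where
  tensorObj := tensor
  whiskerLeft X _ _ f := tensorMap (𝟙 X) f
  whiskerRight f Y := tensorMap f (𝟙 Y)
  tensorHom f g := tensorMap f g
  tensorUnit := unit
  associator X Y Z := mkIso (TensorProduct.assoc ℂ X.V Y.V Z.V) (assoc_comm X Y Z)
  leftUnitor X := mkIso (TensorProduct.lid ℂ X.V) (lid_comm X)
  rightUnitor X := mkIso (TensorProduct.rid ℂ X.V) (rid_comm X)

instance instMonoidal : MonoidalCategory (FinRep A) :=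
  MonoidalCategory.ofTensorHom
    (id_tensorHom_id := fun _ _ => hom_ext (TensorProduct.ext' fun _ _ => rfl))
    (id_tensorHom := fun _ _ _ _ => rfl)
    (tensorHom_id := fun _ _ => rfl)
    (tensorHom_comp_tensorHom := fun _ _ _ _ => hom_ext (TensorProduct.ext' fun _ _ => rfl))
    (associator_naturality := fun _ _ _ =>
      hom_ext (TensorProduct.ext_threefold fun _ _ _ => rfl))
    (leftUnitor_naturality := fun f =>
      hom_ext (TensorProduct.ext' fun z x => (f.map.map_smul z x).symm))
    (rightUnitor_naturality := fun f =>
      hom_ext (TensorProduct.ext' fun x z => (f.map.map_smul z x).symm))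
    (pentagon := fun _ _ _ _ =>
      hom_ext (TensorProduct.ext_fourfold fun _ _ _ _ => rfl))
    (triangle := fun _ _ =>
      hom_ext (TensorProduct.ext_threefold fun x z y =>
        triangle_act x z y))

end Monoidal

end FinRep

end

namespace ResQ

theorem phi_isNormalisedThreeCocycle {ε : ℂˣ} (hε : ε * ε = 1) :
    IsNormalisedThreeCocycle (phi ε) where
  cocycle := by
    intro i j k l
    have h : ∀ i : ZMod 2, i = 0 ∨ i = 1 := by decide
    rcases h i with rfl | rfl <;> rcases h j with rfl | rfl <;> rcases h k with rfl | rfl <;>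
      rcases h l with rfl | rfl <;> simp [phi, hε, show (1 + 1 : ZMod 2) = 0 from rfl]
  normalised := by
    rintro i j k (rfl | rfl | rfl) <;> simp [phi]

theorem e_zero_add_e_one : e 0 + e 1 = 1 := by
  simp only [e, if_true, if_neg (one_ne_zero : (1 : ZMod 2) ≠ 0), ← smul_add]
  rw [add_add_sub_cancel, smul_add, ← add_smul]
  norm_num

theorem e_zero : e 0 = 1 - e 1 := eq_sub_of_add_eq e_zero_add_e_one

theorem e_one : e 1 = (2⁻¹ : ℂ) • (1 - K ^ 2) := by simp [e]

theorem K_sq_mul_K_sq : K ^ 2 * K ^ 2 = 1 := by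
  rw [← pow_add]; exact sat_gen.k_pow

theorem e_one_mul_e_one : e 1 * e 1 = e 1 := by
  rw [e_one, smul_mul_smul_comm, sub_mul, mul_sub, mul_sub, K_sq_mul_K_sq]
  simp only [one_mul, mul_one]
  module

theorem Phi_eq (ε : ℂˣ) : Phi ε = 1 ⊗ₜ[ℂ] (1 ⊗ₜ[ℂ] 1) +
    ((ε : ℂ) - 1) • (e 1 ⊗ₜ[ℂ] (e 1 ⊗ₜ[ℂ] e 1)) := by
  have h : ∀ f : ZMod 2 → Q ⊗[ℂ] (Q ⊗[ℂ] Q), ∑ i, f i = f 0 + f 1 := fun f => Fin.sum_univ_two f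
  simp only [Phi, h, phi, e_zero, TensorProduct.sub_tmul, TensorProduct.tmul_sub]
  simp
  module

theorem comul_E : comul E = 1 ⊗ₜ[ℂ] E + E ⊗ₜ[ℂ] K := lift_E _
theorem comul_F : comul F = Kinv ⊗ₜ[ℂ] F + F ⊗ₜ[ℂ] 1 := lift_F _
theorem comul_K : comul K = K ⊗ₜ[ℂ] K := lift_K _

theorem comul_e_one : comul (e 1) =
    e 1 ⊗ₜ[ℂ] 1 + 1 ⊗ₜ[ℂ] e 1 - (2 : ℂ) • (e 1 ⊗ₜ[ℂ] e 1) := by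
  simp only [e_one, map_smul, map_sub, map_one, map_pow, comul_K,
    Algebra.TensorProduct.tmul_pow, TensorProduct.sub_tmul, TensorProduct.tmul_sub,
    TensorProduct.tmul_smul, ← TensorProduct.smul_tmul', Algebra.TensorProduct.one_def]
  module

theorem counit_e_one : counit (e 1) = 0 := by
  have : counit K = 1 := lift_K _
  simp [e_one, this]

/-- Elements commuting with the generators are central. -/
theorem commute_of_commute_gen {z : Q} (hE : Commute z E) (hF : Commute z F) (hK : Commute z K)
    (hKinv : Commute z Kinv) (a : Q) : Commute z a := by
  obtain ⟨x, rfl⟩ : ∃ x, toQ x = a := RingQuot.mkAlgHom_surjective ℂ Rel a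
  induction x using FreeAlgebra.induction with
  | grade0 r => rw [AlgHom.commutes]; exact (Algebra.commutes r z).symm
  | grade1 g => cases g <;> assumption
  | mul x y hx hy => rw [map_mul]; exact hx.mul_right hy
  | add x y hx hy => rw [map_add]; exact hx.add_right hy

theorem commute_K_sq (a : Q) : Commute (K ^ 2) a := by
  have hK : Commute K Kinv := sat_gen.k_k'.trans sat_gen.k'_k.symm
  refine commute_of_commute_gen ?_ ?_ ((Commute.refl K).pow_left 2) (hK.pow_left 2) a
  · change K ^ 2 * E = E * K ^ 2
    rw [sq, mul_assoc, K_mul_E, mul_neg, ← mul_assoc, K_mul_E, neg_mul, neg_neg, mul_assoc]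
  · change K ^ 2 * F = F * K ^ 2
    rw [sq, mul_assoc, K_mul_F, mul_neg, ← mul_assoc, K_mul_F, neg_mul, neg_neg, mul_assoc]

theorem commute_e_one (a : Q) : Commute (e 1) a := by
  rw [e_one]
  exact ((Commute.one_left a).sub_left (commute_K_sq a)).smul_left _

theorem commute_Phi (ε : ℂˣ) (t : Q ⊗[ℂ] (Q ⊗[ℂ] Q)) : Commute (Phi ε) t := by
  rw [Phi_eq, ← Algebra.TensorProduct.one_def, ← Algebra.TensorProduct.one_def]
  refine (Commute.one_left t).add_left (Commute.smul_left ?_ _)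
  induction t with
  | zero => exact Commute.zero_right _
  | add s t hs ht => exact hs.add_right ht
  | tmul a s =>
    induction s with
    | zero => rw [TensorProduct.tmul_zero]; exact Commute.zero_right _
    | add s t hs ht => rw [TensorProduct.tmul_add]; exact hs.add_right ht
    | tmul b c =>
      simp only [Commute, SemiconjBy, Algebra.TensorProduct.tmul_mul_tmul,
        (commute_e_one _).eq]

theorem Phi_mul_Phi {ε : ℂˣ} (hε : ε * ε = 1) : Phi ε * Phi ε = 1 := by
  have h : (ε : ℂ) * ε = 1 := by rw [← Units.val_mul, hε, Units.val_one]
  simp only [Phi_eq, ← Algebra.TensorProduct.one_def, add_mul, mul_add, one_mul, mul_one,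
    smul_mul_smul_comm, Algebra.TensorProduct.tmul_mul_tmul, e_one_mul_e_one]
  rw [add_assoc, ← add_smul, ← add_smul]
  rw [show (ε : ℂ) - 1 + ((ε : ℂ) - 1 + ((ε : ℂ) - 1) * ((ε : ℂ) - 1)) = 0 by
    linear_combination h, zero_smul, add_zero]

theorem isUnit_Phi {ε : ℂˣ} (hε : ε * ε = 1) : IsUnit (Phi ε) :=
  ⟨⟨_, _, Phi_mul_Phi hε, Phi_mul_Phi hε⟩, rfl⟩

theorem inverse_Phi {ε : ℂˣ} (hε : ε * ε = 1) : Ring.inverse (Phi ε) = Phi ε :=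
  Ring.inverse_unit ⟨_, _, Phi_mul_Phi hε, Phi_mul_Phi hε⟩

set_option maxSynthPendingDepth 6 in
theorem cocycle_Phi {ε : ℂˣ} (hε : ε = 1 ∨ ε = -1) :
    QB.comul₁ comul (Phi ε) * QB.comul₃ comul (Phi ε) =
      QB.tensorOne (Phi ε) * QB.comul₂ comul (Phi ε) * QB.oneTensor (Phi ε) := by
  simp only [Phi_eq, map_add, map_smul, QB.comul₁, QB.comul₂, QB.comul₃, QB.tensorOne,
    QB.oneTensor, QB.comulLeft, QB.comulRight]
  simp [comul_e_one]
  rcases hε with rfl | rfl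
  · simp [Algebra.TensorProduct.one_def]
  simp only [TensorProduct.add_tmul, TensorProduct.tmul_add,
    TensorProduct.sub_tmul, TensorProduct.tmul_sub, ← TensorProduct.smul_tmul',
    TensorProduct.tmul_smul, Algebra.TensorProduct.one_def, map_add, map_sub, map_smul,
    Algebra.TensorProduct.assoc_tmul]
  simp only [add_mul, mul_add, sub_mul, mul_sub, smul_mul_assoc,
      mul_smul_comm, Algebra.TensorProduct.tmul_mul_tmul, e_one_mul_e_one, one_mul, mul_one]
  push_cast
  module

theorem isQuasiBialgebra {ε : ℂˣ} (hε : ε = 1 ∨ ε = -1) :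
    QB.IsQuasiBialgebra comul counit (Phi ε) := by
  have hsq : ε * ε = 1 := by rcases hε with rfl | rfl <;> simp
  refine ⟨isUnit_Phi hsq, fun a => ?_, fun a => ?_, fun a => ?_, ?_, cocycle_Phi hε⟩
  · have h := Coalgebra.rTensor_counit_comul (R := ℂ) a
    exact (congrArg (TensorProduct.lid ℂ Q) h).trans (by simp)
  · have h := Coalgebra.lTensor_counit_comul (R := ℂ) a
    exact (congrArg (TensorProduct.rid ℂ Q) h).trans (by simp)
  · have h : QB.comulLeft comul (comul a) = QB.comulRight comul (comul a) :=
      Coalgebra.coassoc_apply (R := ℂ) a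
    rw [h, (commute_Phi ε _).eq, inverse_Phi hsq, mul_assoc, Phi_mul_Phi hsq, mul_one]
  · simp [Phi_eq, QB.counitMiddle, QB.counitLeft, counit_e_one]

end ResQ

namespace ResQ

theorem sat_sign : Sat (0 : ℂ) 0 (-1) (-1) := by
  constructor <;> norm_num

/-- The one-dimensional representation with `E, F ↦ 0` and `K ↦ -1`. -/
noncomputable def sign : Q →ₐ[ℂ] ℂ := lift sat_sign

theorem sat_steinberg : Sat (!![0, 1; 0, 0] : Matrix (Fin 2) (Fin 2) ℂ) !![0, 0; 1, 0]
    !![Complex.I, 0; 0, -Complex.I] !![-Complex.I, 0; 0, Complex.I] := by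
  have h : (Complex.I - Complex.I⁻¹)⁻¹ * (Complex.I - -Complex.I) = 1 := by
    rw [Complex.inv_I]; exact inv_mul_cancel₀ (by simp [← two_mul])
  have h' : (Complex.I - Complex.I⁻¹)⁻¹ * (-Complex.I - Complex.I) = -1 := by
    linear_combination -h
  constructor
  · simp [Matrix.one_fin_two]
  · simp [Matrix.one_fin_two]
  · ext i j; fin_cases i <;> fin_cases j <;> simp
  · ext i j; fin_cases i <;> fin_cases j <;> simp
  · ext i j; fin_cases i <;> fin_cases j <;> simp [-Complex.inv_I, -sub_neg_eq_add, h, h']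
  · ext i j; fin_cases i <;> fin_cases j <;> simp [sq]
  · ext i j; fin_cases i <;> fin_cases j <;> simp [sq]
  · simp [pow_succ, Matrix.one_fin_two]

/-- The two-dimensional simple representation with highest weight `i`. -/
noncomputable def steinberg : Q →ₐ[ℂ] Module.End ℂ (Fin 2 → ℂ) :=
  (Matrix.toLinAlgEquiv' (R := ℂ) (n := Fin 2)).toAlgHom.comp (lift sat_steinberg)

theorem steinberg_E (v : Fin 2 → ℂ) : steinberg E v = ![v 1, 0] := by
  ext i; fin_cases i <;> simp [steinberg, Matrix.toLinAlgEquiv'_apply, Matrix.mulVec, dotProduct]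

theorem steinberg_F (v : Fin 2 → ℂ) : steinberg F v = ![0, v 0] := by
  ext i; fin_cases i <;> simp [steinberg, Matrix.toLinAlgEquiv'_apply, Matrix.mulVec, dotProduct]

theorem steinberg_K (v : Fin 2 → ℂ) :
    steinberg K v = ![Complex.I * v 0, -Complex.I * v 1] := by
  ext i; fin_cases i <;> simp [steinberg, Matrix.toLinAlgEquiv'_apply, Matrix.mulVec, dotProduct]

theorem steinberg_Kinv (v : Fin 2 → ℂ) :
    steinberg Kinv v = ![-Complex.I * v 0, Complex.I * v 1] := by
  ext i; fin_cases i <;> simp [steinberg, Matrix.toLinAlgEquiv'_apply, Matrix.mulVec, dotProduct]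

/-- The invariant vector in the tensor square of `steinberg`. -/
noncomputable def invariant : (Fin 2 → ℂ) ⊗[ℂ] (Fin 2 → ℂ) :=
  ![0, 1] ⊗ₜ[ℂ] ![1, 0] - Complex.I • (![1, 0] ⊗ₜ[ℂ] ![0, 1])

theorem invariant_ne_zero : invariant ≠ 0 := by
  intro h
  have := congrArg (LinearMap.mul' ℂ ℂ ∘ₗ
    TensorProduct.map (LinearMap.proj (R := ℂ) (φ := fun _ : Fin 2 => ℂ) 1)
      (LinearMap.proj (R := ℂ) (φ := fun _ : Fin 2 => ℂ) 0)) h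
  simp [invariant] at this

theorem act_comul_invariant (a : Q) :
    FinRep.act steinberg steinberg (comul a) invariant = counit a • invariant := by
  have hE₀ : steinberg E ![1, 0] = 0 := by ext i; fin_cases i <;> simp [steinberg_E]
  have hE₁ : steinberg E ![0, 1] = ![1, 0] := by simp [steinberg_E]
  have hF₀ : steinberg F ![1, 0] = ![0, 1] := by simp [steinberg_F]
  have hF₁ : steinberg F ![0, 1] = 0 := by ext i; fin_cases i <;> simp [steinberg_F]
  have hK₀ : steinberg K ![1, 0] = Complex.I • ![1, 0] := by simp [steinberg_K]
  have hK₁ : steinberg K ![0, 1] = (-Complex.I) • ![0, 1] := by simp [steinberg_K]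
  have hL₀ : steinberg Kinv ![1, 0] = (-Complex.I) • ![1, 0] := by simp [steinberg_Kinv]
  have hL₁ : steinberg Kinv ![0, 1] = Complex.I • ![0, 1] := by simp [steinberg_Kinv]
  have hI : Complex.I * Complex.I = -1 := Complex.I_mul_I
  obtain ⟨x, rfl⟩ : ∃ x, toQ x = a := RingQuot.mkAlgHom_surjective ℂ Rel a
  induction x using FreeAlgebra.induction with
  | grade0 r => simp only [AlgHom.commutes]; rfl
  | grade1 g =>
    cases g
    · change FinRep.act steinberg steinberg (comul E) invariant = counit E • invariant
      rw [comul_E, show counit E = 0 from lift_E _]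
      simp only [invariant, map_sub, map_smul, map_add, map_one, LinearMap.add_apply,
        FinRep.act_tmul, Module.End.one_apply, hE₀, hE₁, hK₀, hK₁, TensorProduct.tmul_smul,
        TensorProduct.tmul_zero, TensorProduct.zero_tmul]
      module
    · change FinRep.act steinberg steinberg (comul F) invariant = counit F • invariant
      rw [comul_F, show counit F = 0 from lift_F _]
      simp only [invariant, map_sub, map_smul, map_add, map_one, LinearMap.add_apply,
        FinRep.act_tmul, Module.End.one_apply, hF₀, hF₁, hL₀, hL₁, TensorProduct.tmul_zero,
        TensorProduct.zero_tmul, ← TensorProduct.smul_tmul']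
      module
    · change FinRep.act steinberg steinberg (comul K) invariant = counit K • invariant
      rw [comul_K, show counit K = 1 from lift_K _]
      simp only [invariant, map_sub, map_smul, FinRep.act_tmul, hK₀, hK₁,
        TensorProduct.tmul_smul, ← TensorProduct.smul_tmul', smul_smul, neg_mul, mul_neg, hI,
        neg_neg, one_smul]
    · change FinRep.act steinberg steinberg (comul Kinv) invariant = counit Kinv • invariant
      rw [show comul Kinv = Kinv ⊗ₜ[ℂ] Kinv from lift_Kinv _,
        show counit Kinv = 1 from lift_Kinv _]
      simp only [invariant, map_sub, map_smul, FinRep.act_tmul, hL₀, hL₁,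
        TensorProduct.tmul_smul, ← TensorProduct.smul_tmul', smul_smul, neg_mul, mul_neg, hI,
        neg_neg, one_smul]
  | mul x y hx hy =>
    simp only [map_mul, Module.End.mul_apply, hy, map_smul, hx, smul_smul, mul_comm]
  | add x y hx hy => simp only [map_add, LinearMap.add_apply, hx, hy, add_smul]

/-- An involution of `steinberg` commuting with `K` and anticommuting with `E` changes the sign
of the invariant vector of the tensor square. -/
theorem map_invariant {T : Module.End ℂ (Fin 2 → ℂ)}
    (hK : ∀ v, T (steinberg K v) = steinberg K (T v))
    (hE : ∀ v, T (steinberg E v) = -steinberg E (T v)) (hT : ∀ v, T (T v) = v) :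
    TensorProduct.map T T invariant = -invariant := by
  have h0 : T ![1, 0] = T ![1, 0] 0 • ![1, 0] := by
    have := congrFun (hK ![1, 0]) 1
    rw [steinberg_K, steinberg_K, show ![Complex.I * ![(1 : ℂ), 0] 0, -Complex.I * ![(1 : ℂ), 0] 1]
      = Complex.I • ![1, 0] by simp, map_smul] at this
    have h : T ![1, 0] 1 = 0 := by
      have h2 : (2 * Complex.I) * T ![1, 0] 1 = 0 := by
        simp at this; linear_combination this
      simpa using h2
    ext i; fin_cases i <;> simp [h]
  have h1 : T ![0, 1] = T ![0, 1] 1 • ![0, 1] := by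
    have := congrFun (hK ![0, 1]) 0
    rw [steinberg_K, steinberg_K, show ![Complex.I * ![(0 : ℂ), 1] 0, -Complex.I * ![(0 : ℂ), 1] 1]
      = (-Complex.I) • ![0, 1] by simp, map_smul] at this
    have h : T ![0, 1] 0 = 0 := by
      have h2 : (2 * Complex.I) * T ![0, 1] 0 = 0 := by
        simp at this; linear_combination -this
      simpa using h2
    ext i; fin_cases i <;> simp [h]
  have h2 : T ![1, 0] 0 = -T ![0, 1] 1 := by
    have := congrFun (hE ![0, 1]) 0
    simpa [steinberg_E] using this
  have h3 : T ![0, 1] 1 * T ![0, 1] 1 = 1 := by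
    have := congrFun (hT ![0, 1]) 1
    rw [h1, map_smul, h1] at this
    simpa using this
  generalize T ![0, 1] 1 = b at *
  rw [h2] at h0
  simp only [invariant, map_sub, map_smul, TensorProduct.map_tmul, h0, h1,
    TensorProduct.tmul_smul, ← TensorProduct.smul_tmul', smul_smul]
  simp only [mul_neg, neg_mul, h3]
  module

/-- The obstruction to a braiding of `sign` with `steinberg`. -/
theorem map_invariant_ne {T : Module.End ℂ (Fin 2 → ℂ)}
    (hK : ∀ v, T (steinberg K v) = steinberg K (T v))
    (hE : ∀ v, T (steinberg E v) = -steinberg E (T v)) (hT : ∀ v, T (T v) = v) :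
    TensorProduct.map T T invariant ≠ invariant := by
  rw [map_invariant hK hE hT]
  intro h
  have h2 : (2 : ℂ) • invariant = 0 := by rw [two_smul]; nth_rw 1 [← h]; exact neg_add_cancel _
  exact invariant_ne_zero ((smul_eq_zero.mp h2).resolve_left two_ne_zero)

/-- No involutive grouplike element commutes with `K` and anticommutes with `E`. -/
theorem not_grouplike {r : Q} (hK : r * K = K * r) (hE : r * E = -(E * r)) (hr : r * r = 1)
    (hcomul : comul r = r ⊗ₜ[ℂ] r) (hcounit : counit r = 1) : False := by
  have hmul : ∀ a b v, steinberg a (steinberg b v) = steinberg (a * b) v := fun a b v => by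
    rw [map_mul]; rfl
  refine map_invariant_ne (T := steinberg r) (fun v => ?_) (fun v => ?_) (fun v => ?_) ?_
  · rw [hmul, hmul, hK]
  · rw [hmul, hmul, hE, map_neg]; rfl
  · rw [hmul, hr, map_one]; rfl
  · have h := act_comul_invariant r
    rw [hcomul, hcounit, one_smul] at h
    refine Eq.trans ?_ h
    rw [FinRep.act, AlgHom.comp_apply, Algebra.TensorProduct.map_tmul,
      Module.endTensorEndAlgHom_apply]
    rfl

end ResQ

namespace QB

variable {A : Type} [Ring A] [Algebra ℂ A]

/-- `χ ⊗ id ⊗ id : A ⊗ A ⊗ A → A ⊗ A`. -/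
noncomputable def sliceLeft (χ : A →ₐ[ℂ] ℂ) : A ⊗[ℂ] (A ⊗[ℂ] A) →ₐ[ℂ] A ⊗[ℂ] A :=
  (Algebra.TensorProduct.lid ℂ (A ⊗[ℂ] A)).toAlgHom.comp
    (Algebra.TensorProduct.map χ (AlgHom.id ℂ (A ⊗[ℂ] A)))

@[simp] theorem sliceLeft_tmul (χ : A →ₐ[ℂ] ℂ) (a : A) (t : A ⊗[ℂ] A) :
    sliceLeft χ (a ⊗ₜ t) = χ a • t := by simp [sliceLeft]

@[simp] theorem counitLeft_tmul (χ : A →ₐ[ℂ] ℂ) (a b : A) :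
    counitLeft χ (a ⊗ₜ b) = χ a • b := by simp [counitLeft]

theorem sliceLeft_emb13 (χ : A →ₐ[ℂ] ℂ) (R : A ⊗[ℂ] A) :
    sliceLeft χ (emb13 R) = 1 ⊗ₜ counitLeft χ R := by
  induction R with
  | zero => simp
  | add s t hs ht => simp only [map_add, hs, ht, TensorProduct.tmul_add]
  | tmul a b => simp [emb13]

theorem sliceLeft_emb12 (χ : A →ₐ[ℂ] ℂ) (R : A ⊗[ℂ] A) :
    sliceLeft χ (emb12 R) = counitLeft χ R ⊗ₜ 1 := by
  induction R with
  | zero => simp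
  | add s t hs ht => simp only [map_add, hs, ht, TensorProduct.add_tmul]
  | tmul a b => simp [emb12, TensorProduct.smul_tmul']

theorem sliceLeft_emb23 (χ : A →ₐ[ℂ] ℂ) (R : A ⊗[ℂ] A) : sliceLeft χ (emb23 R) = R := by
  simp [emb23]

theorem sliceLeft_comulRight (Δ : A →ₐ[ℂ] A ⊗[ℂ] A) (χ : A →ₐ[ℂ] ℂ) (R : A ⊗[ℂ] A) :
    sliceLeft χ (comulRight Δ R) = Δ (counitLeft χ R) := by
  induction R with
  | zero => simp
  | add s t hs ht => simp only [map_add, hs, ht]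
  | tmul a b => simp [comulRight]

theorem counitLeft_sliceLeft_comulLeft (Δ : A →ₐ[ℂ] A ⊗[ℂ] A) (χ ψ : A →ₐ[ℂ] ℂ)
    (R : A ⊗[ℂ] A) : counitLeft ψ (sliceLeft χ (comulLeft Δ R)) =
      counitLeft (ψ.comp ((counitLeft χ).comp Δ)) R := by
  induction R with
  | zero => simp
  | add s t hs ht => simp only [map_add, hs, ht]
  | tmul a b =>
    simp only [comulLeft, AlgHom.comp_apply, Algebra.TensorProduct.map_tmul, AlgHom.id_apply,
      counitLeft_tmul]
    induction Δ a with
    | zero => simp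
    | add s t hs ht => simp only [TensorProduct.add_tmul, map_add, hs, ht, add_smul]
    | tmul c d => simp [mul_smul]

end QB

namespace ResQ

theorem sign_comp_comul : sign.comp ((QB.counitLeft sign).comp comul) = counit := by
  apply hom_ext <;> simp [comul, sign, counit]

theorem counit_comp_comul : counit.comp ((QB.counitLeft counit).comp comul) = counit := by
  apply hom_ext <;> simp [comul, counit]

theorem sign_e_one : sign (e 1) = 0 := by
  have : sign K = -1 := lift_K _
  simp [e_one, this]

theorem sliceLeft_Phi {χ : Q →ₐ[ℂ] ℂ} (hχ : χ (e 1) = 0) (ε : ℂˣ) :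
    QB.sliceLeft χ (Phi ε) = 1 := by
  simp [Phi_eq, hχ, Algebra.TensorProduct.one_def]

theorem perm132_Phi (ε : ℂˣ) : QB.perm132 (Phi ε) = Phi ε := by
  simp [Phi_eq, QB.perm132]

theorem perm213_Phi (ε : ℂˣ) : QB.perm213 (Phi ε) = Phi ε := by
  simp [Phi_eq, QB.perm213]

theorem not_isQuasiTriangular {ε : ℂˣ} (hε : ε * ε = 1) :
    ¬ QB.IsQuasiTriangular comul (Phi ε) := by
  rintro ⟨R, hR⟩
  have hl := hR.hexagon_left
  have hr := hR.hexagon_right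
  simp only [QB.perm231, QB.perm312, AlgHom.comp_apply, perm132_Phi, perm213_Phi,
    inverse_Phi hε] at hl hr
  have hleft : ∀ χ ψ : Q →ₐ[ℂ] ℂ, χ (e 1) = 0 →
      QB.counitLeft (ψ.comp ((QB.counitLeft χ).comp comul)) R =
        QB.counitLeft χ R * QB.counitLeft ψ R := by
    intro χ ψ hχ
    rw [← QB.counitLeft_sliceLeft_comulLeft, hl]
    simp only [map_mul, sliceLeft_Phi hχ, QB.sliceLeft_emb13, QB.sliceLeft_emb23]
    simp
  have hcounit : QB.counitLeft counit R = 1 := by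
    have h := hleft counit counit counit_e_one
    rw [counit_comp_comul] at h
    exact ((hR.isUnit.map (QB.counitLeft counit)).mul_eq_left.mp h.symm)
  set r := QB.counitLeft sign R with hr_def
  have hsq : r * r = 1 := by
    have h := hleft sign sign sign_e_one
    rw [sign_comp_comul, hcounit] at h
    exact h.symm
  have hgroup : comul r = r ⊗ₜ[ℂ] r := by
    rw [hr_def, ← QB.sliceLeft_comulRight, hr]
    simp only [map_mul, sliceLeft_Phi sign_e_one, QB.sliceLeft_emb13, QB.sliceLeft_emb12]
    simp
  have hint : ∀ a, r * QB.counitLeft sign (comul a) =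
      QB.counitLeft sign (Algebra.TensorProduct.comm ℂ Q Q (comul a)) * r := fun a => by
    rw [hr_def, ← map_mul, ← map_mul, hR.intertwine]
  have sE : sign E = 0 := lift_E _
  have sK : sign K = -1 := lift_K _
  have hone : counit r = 1 := by
    have h : counit r • r = r := by
      have h := Coalgebra.rTensor_counit_comul (R := ℂ) r
      have h' := congrArg (TensorProduct.lid ℂ Q) h
      have h'' : QB.counitLeft counit (comul r) = r := h'.trans (by simp)
      rwa [hgroup, QB.counitLeft_tmul] at h''
    have h2 := congrArg (fun x => counit (x * r)) h
    simpa [hsq] using h2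
  refine not_grouplike ?_ ?_ hsq hgroup hone
  · have h := hint K
    simpa [comul_K, sK] using h
  · have h := hint E
    simpa [comul_E, sE, sK] using h

theorem Phi_one : Phi 1 = 1 := by simp [Phi_eq, Algebra.TensorProduct.one_def]

theorem not_isBialgebraRMatrix (R : Q ⊗[ℂ] Q) : ¬ QB.IsBialgebraRMatrix comul R := fun hR =>
  not_isQuasiTriangular (ε := 1) (one_mul 1) ⟨R, hR.isUnit, hR.intertwine,
    by simp [Phi_one, hR.hexagon_left], by simp [Phi_one, hR.hexagon_right]⟩

end ResQ

namespace FinRep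

open MonoidalCategory

theorem mul'_act_lmul {B C : Type} [Ring B] [Algebra ℂ B] [Ring C] [Algebra ℂ C]
    (χ : B →ₐ[ℂ] ℂ) (ψ : C →ₐ[ℂ] ℂ) (t : B ⊗[ℂ] C) (x : ℂ ⊗[ℂ] ℂ) :
    LinearMap.mul' ℂ ℂ (act ((Algebra.lmul ℂ ℂ).comp χ) ((Algebra.lmul ℂ ℂ).comp ψ) t x) =
      LinearMap.mul' ℂ ℂ (TensorProduct.map χ.toLinearMap ψ.toLinearMap t) *
        LinearMap.mul' ℂ ℂ x := by
  induction t with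
  | zero => simp
  | add s t hs ht => simp only [map_add, LinearMap.add_apply, add_mul, hs, ht]
  | tmul b c =>
    induction x with
    | zero => simp
    | add s t hs ht => simp only [map_add, mul_add, hs, ht]
    | tmul z w =>
      simp
      ring

variable {A : Type} [Ring A] [Bialgebra ℂ A]

/-- The one-dimensional representation given by a character. -/
def ofChar (χ : A →ₐ[ℂ] ℂ) : FinRep A where
  V := ℂ
  ρ := (Algebra.lmul ℂ ℂ).comp χ

variable [BraidedCategory (FinRep A)] (χ : A →ₐ[ℂ] ℂ)

/-- The braiding with a one-dimensional representation, as an endomorphism of the underlying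
vector space. -/
noncomputable def charBraiding (Y : FinRep A) : Y.V →ₗ[ℂ] Y.V :=
  (TensorProduct.rid ℂ Y.V).toLinearMap ∘ₗ (β_ (ofChar χ) Y).hom.map ∘ₗ
    (TensorProduct.lid ℂ Y.V).symm.toLinearMap

theorem braiding_one_tmul (Y : FinRep A) (y : Y.V) :
    (β_ (ofChar χ) Y).hom.map ((1 : ℂ) ⊗ₜ[ℂ] y) = charBraiding χ Y y ⊗ₜ[ℂ] (1 : ℂ) :=
  ((TensorProduct.rid ℂ Y.V).symm_apply_apply _).symm

theorem charBraiding_comm (Y : FinRep A) (a : A) (y : Y.V) :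
    charBraiding χ Y (Y.ρ (TensorProduct.lid ℂ A
        (LinearMap.rTensor A χ.toLinearMap (Coalgebra.comul (R := ℂ) a))) y) =
      Y.ρ (TensorProduct.rid ℂ A
        (LinearMap.lTensor A χ.toLinearMap (Coalgebra.comul (R := ℂ) a))) (charBraiding χ Y y) := by
  have h1 := lid_act Y.ρ χ (Coalgebra.comul (R := ℂ) a) ((TensorProduct.lid ℂ Y.V).symm y)
  have h2 := rid_act Y.ρ χ (Coalgebra.comul (R := ℂ) a)
    ((β_ (ofChar χ) Y).hom.map ((TensorProduct.lid ℂ Y.V).symm y))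
  have h3 := (β_ (ofChar χ) Y).hom.comm a ((TensorProduct.lid ℂ Y.V).symm y)
  rw [LinearEquiv.apply_symm_apply] at h1
  rw [← h1]
  refine Eq.trans ?_ h2
  refine (congrArg (fun z => TensorProduct.rid ℂ Y.V ((β_ (ofChar χ) Y).hom.map z))
    ((TensorProduct.lid ℂ Y.V).symm_apply_apply _)).trans ?_
  exact congrArg (TensorProduct.rid ℂ Y.V) h3

theorem charBraiding_naturality {Y Z : FinRep A} (f : Y ⟶ Z) (y : Y.V) :
    charBraiding χ Z (f.map y) = f.map (charBraiding χ Y y) := by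
  have h := congrArg (fun g => TensorProduct.rid ℂ Z.V (Hom.map g ((1 : ℂ) ⊗ₜ[ℂ] y)))
    (BraidedCategory.braiding_naturality_right (ofChar χ) f)
  refine Eq.trans h ?_
  change TensorProduct.rid ℂ Z.V (TensorProduct.map f.map LinearMap.id
    ((β_ (ofChar χ) Y).hom.map ((1 : ℂ) ⊗ₜ[ℂ] y))) = _
  rw [braiding_one_tmul]
  exact (TensorProduct.rid_tmul (R := ℂ) _ _).trans (one_smul ℂ _)

theorem charBraiding_unit (z : ℂ) : charBraiding χ (unit : FinRep A) z = z := by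
  have h := congrArg (fun g => TensorProduct.lid ℂ ℂ (Hom.map g ((1 : ℂ) ⊗ₜ[ℂ] z)))
    (braiding_tensorUnit_right (ofChar χ))
  have h' : TensorProduct.lid ℂ ℂ ((β_ (ofChar χ) (unit : FinRep A)).hom.map
      ((1 : ℂ) ⊗ₜ[ℂ] z)) = z := by
    refine h.trans ?_
    change (1 : ℂ) • (z • (1 : ℂ)) = z
    simp
  have h'' := congrArg (TensorProduct.lid ℂ ℂ) (braiding_one_tmul χ (unit : FinRep A) z)
  exact (mul_one (M := ℂ) (charBraiding χ (unit : FinRep A) z)).symm.trans (h''.symm.trans h')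

theorem charBraiding_tensor (Y Z : FinRep A) (t : Y.V ⊗[ℂ] Z.V) :
    charBraiding χ (tensor Y Z) t =
      TensorProduct.map (charBraiding χ Y) (charBraiding χ Z) t := by
  induction t with
  | zero => exact (map_zero _).trans (map_zero _).symm
  | add s t hs ht => exact (map_add _ s t).trans ((congrArg₂ _ hs ht).trans (map_add _ s t).symm)
  | tmul y z =>
    have h := congrArg (fun g => Hom.map g (((1 : ℂ) ⊗ₜ[ℂ] y) ⊗ₜ[ℂ] z))
      (BraidedCategory.hexagon_forward (ofChar χ) Y Z)
    have hl : Hom.map ((α_ (ofChar χ) Y Z).hom ≫ (β_ (ofChar χ) (Y ⊗ Z)).hom ≫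
        (α_ Y Z (ofChar χ)).hom) (((1 : ℂ) ⊗ₜ[ℂ] y) ⊗ₜ[ℂ] z) =
        TensorProduct.assoc ℂ Y.V Z.V ℂ
          (charBraiding χ (tensor Y Z) (y ⊗ₜ[ℂ] z) ⊗ₜ[ℂ] (1 : ℂ)) :=
      congrArg (TensorProduct.assoc ℂ Y.V Z.V ℂ)
        (braiding_one_tmul χ (tensor Y Z) (y ⊗ₜ[ℂ] z))
    have hr : Hom.map (((β_ (ofChar χ) Y).hom ▷ Z) ≫ (α_ Y (ofChar χ) Z).hom ≫
        (Y ◁ (β_ (ofChar χ) Z).hom)) (((1 : ℂ) ⊗ₜ[ℂ] y) ⊗ₜ[ℂ] z) =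
        charBraiding χ Y y ⊗ₜ[ℂ] (charBraiding χ Z z ⊗ₜ[ℂ] (1 : ℂ)) := by
      change TensorProduct.map LinearMap.id (β_ (ofChar χ) Z).hom.map
        (TensorProduct.assoc ℂ Y.V ℂ Z.V
          ((β_ (ofChar χ) Y).hom.map ((1 : ℂ) ⊗ₜ[ℂ] y) ⊗ₜ[ℂ] z)) = _
      rw [braiding_one_tmul]
      exact congrArg (charBraiding χ Y y ⊗ₜ[ℂ] ·) (braiding_one_tmul χ Z z)
    have h' := hl.symm.trans (h.trans hr)
    have h'' := congrArg (fun t => TensorProduct.rid ℂ (Y.V ⊗[ℂ] Z.V)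
      ((TensorProduct.assoc ℂ Y.V Z.V ℂ).symm t)) h'
    simp only [LinearEquiv.symm_apply_apply, TensorProduct.assoc_symm_tmul,
      TensorProduct.rid_tmul, one_smul] at h''
    exact (one_smul ℂ (charBraiding χ (tensor Y Z) (y ⊗ₜ[ℂ] z))).symm.trans h''

theorem charBraiding_charBraiding
    (hχ : ∀ a, LinearMap.mul' ℂ ℂ (TensorProduct.map χ.toLinearMap χ.toLinearMap
      (Coalgebra.comul (R := ℂ) a)) = Coalgebra.counit (R := ℂ) a)
    (Y : FinRep A) (y : Y.V) : charBraiding χ Y (charBraiding χ Y y) = y := by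
  let m : ofChar χ ⊗ ofChar χ ⟶ 𝟙_ (FinRep A) := ⟨LinearMap.mul' ℂ ℂ, by
    intro a x
    change _ = Coalgebra.counit (R := ℂ) a * LinearMap.mul' ℂ ℂ x
    rw [← hχ a]
    change LinearMap.mul' ℂ ℂ (act (ofChar χ).ρ (ofChar χ).ρ (Coalgebra.comul (R := ℂ) a) x) = _
    exact mul'_act_lmul χ χ _ x⟩
  have hn := congrArg (fun g => Hom.map g (((1 : ℂ) ⊗ₜ[ℂ] (1 : ℂ)) ⊗ₜ[ℂ] y))
    (BraidedCategory.braiding_naturality_left m Y)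
  have hh := congrArg (fun g => Hom.map g ((1 : ℂ) ⊗ₜ[ℂ] ((1 : ℂ) ⊗ₜ[ℂ] y)))
    (BraidedCategory.hexagon_reverse (ofChar χ) (ofChar χ) Y)
  have hu := congrArg (fun g => Hom.map g ((1 : ℂ) ⊗ₜ[ℂ] y)) (braiding_tensorUnit_left Y)
  have hr : Hom.map ((ofChar χ ◁ (β_ (ofChar χ) Y).hom) ≫ (α_ (ofChar χ) Y (ofChar χ)).inv ≫
      ((β_ (ofChar χ) Y).hom ▷ ofChar χ)) ((1 : ℂ) ⊗ₜ[ℂ] ((1 : ℂ) ⊗ₜ[ℂ] y)) =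
      (charBraiding χ Y (charBraiding χ Y y) ⊗ₜ[ℂ] (1 : ℂ)) ⊗ₜ[ℂ] (1 : ℂ) := by
    change TensorProduct.map (β_ (ofChar χ) Y).hom.map LinearMap.id
      ((TensorProduct.assoc ℂ ℂ Y.V ℂ).symm
        ((1 : ℂ) ⊗ₜ[ℂ] ((β_ (ofChar χ) Y).hom.map ((1 : ℂ) ⊗ₜ[ℂ] y)))) = _
    rw [braiding_one_tmul]
    exact congrArg (· ⊗ₜ[ℂ] (1 : ℂ)) (braiding_one_tmul χ Y (charBraiding χ Y y))
  have hh' : (TensorProduct.assoc ℂ Y.V ℂ ℂ).symm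
      ((β_ (ofChar χ ⊗ ofChar χ) Y).hom.map (((1 : ℂ) ⊗ₜ[ℂ] (1 : ℂ)) ⊗ₜ[ℂ] y)) =
      (charBraiding χ Y (charBraiding χ Y y) ⊗ₜ[ℂ] (1 : ℂ)) ⊗ₜ[ℂ] (1 : ℂ) := hh.trans hr
  replace hh' := (LinearEquiv.symm_apply_eq _).mp hh'
  have hu' : (β_ (𝟙_ (FinRep A)) Y).hom.map (((1 : ℂ) * (1 : ℂ)) ⊗ₜ[ℂ] y) = y ⊗ₜ[ℂ] (1 : ℂ) := by
    rw [one_mul]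
    refine hu.trans ?_
    change (TensorProduct.rid ℂ Y.V).symm ((1 : ℂ) • y) = _
    rw [one_smul]; rfl
  have hn' : (β_ (𝟙_ (FinRep A)) Y).hom.map (((1 : ℂ) * (1 : ℂ)) ⊗ₜ[ℂ] y) =
      TensorProduct.map LinearMap.id (LinearMap.mul' ℂ ℂ)
        ((β_ (ofChar χ ⊗ ofChar χ) Y).hom.map (((1 : ℂ) ⊗ₜ[ℂ] (1 : ℂ)) ⊗ₜ[ℂ] y)) := hn
  have h := hu'.symm.trans (hn'.trans (congrArg
    (TensorProduct.map LinearMap.id (LinearMap.mul' ℂ ℂ)) hh'))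
  simpa using (congrArg (TensorProduct.rid ℂ Y.V) h).symm

end FinRep

namespace ResQ

open FinRep

/-- `steinberg` as an object of the category of representations. -/
noncomputable def steinbergRep : FinRep Q where
  V := Fin 2 → ℂ
  ρ := steinberg

theorem isEmpty_braidedCategory : IsEmpty (BraidedCategory (FinRep Q)) := by
  refine ⟨fun _ => ?_⟩
  have hc := charBraiding_comm sign steinbergRep
  have sE : sign E = 0 := lift_E _
  have sK : sign K = -1 := lift_K _
  have cE : Coalgebra.comul (R := ℂ) E = 1 ⊗ₜ[ℂ] E + E ⊗ₜ[ℂ] K := comul_E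
  have cK : Coalgebra.comul (R := ℂ) K = K ⊗ₜ[ℂ] K := comul_K
  refine map_invariant_ne (T := charBraiding sign steinbergRep) (fun v => ?_) (fun v => ?_)
    (charBraiding_charBraiding sign ?_ steinbergRep) ?_
  · have h := hc K v
    simp only [cK, LinearMap.rTensor_tmul, LinearMap.lTensor_tmul, AlgHom.toLinearMap_apply, sK,
      TensorProduct.lid_tmul, TensorProduct.rid_tmul, map_smul, LinearMap.smul_apply] at h
    have h' := (map_smul (charBraiding sign steinbergRep) (-1 : ℂ) (steinberg K v)).symm.trans h
    exact smul_right_injective (Fin 2 → ℂ) (neg_ne_zero.mpr (one_ne_zero (α := ℂ))) h'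
  · have h := hc E v
    simp [cE, sE, sK] at h
    exact h
  · have h : (Algebra.TensorProduct.lift sign sign (fun _ _ => Commute.all _ _)).comp comul
        = counit := by
      apply hom_ext <;> simp [comul, sign, counit]
    intro a
    refine Eq.trans ?_ (DFunLike.congr_fun h a)
    change LinearMap.mul' ℂ ℂ (TensorProduct.map _ _ (comul a)) =
      Algebra.TensorProduct.lift sign sign (fun _ _ => Commute.all _ _) (comul a)
    induction comul a with
    | zero => simp
    | add s t hs ht => simp only [map_add, hs, ht]
    | tmul b c => simp
  · let w : (unit : FinRep Q) ⟶ tensor steinbergRep steinbergRep :=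
      ⟨LinearMap.toSpanSingleton ℂ _ invariant, fun a (z : ℂ) => by
        change (counit a * z) • invariant =
          act steinberg steinberg (comul a) (z • invariant)
        rw [map_smul, act_comul_invariant, smul_smul, mul_comm]⟩
    have h := charBraiding_naturality sign w (1 : ℂ)
    have hw : w.map (1 : ℂ) = invariant := one_smul ℂ invariant
    have hu := (congrArg w.map (charBraiding_unit sign (1 : ℂ))).trans hw
    refine (charBraiding_tensor sign steinbergRep steinbergRep invariant).symm.trans ?_
    exact (congrArg (charBraiding sign (tensor steinbergRep steinbergRep)) hw).symm.trans
      (h.trans hu)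

end ResQ

theorem mainTheorem2 :
    (∀ ε : ℂˣ, ε = 1 ∨ ε = -1 →
      ResQ.IsNormalisedThreeCocycle (ResQ.phi ε) ∧
      ResQ.Phi ε = 1 ⊗ₜ[ℂ] (1 ⊗ₜ[ℂ] 1) +
        ((ε : ℂ) - 1) • (ResQ.e 1 ⊗ₜ[ℂ] (ResQ.e 1 ⊗ₜ[ℂ] ResQ.e 1)) ∧
      QB.IsQuasiBialgebra ResQ.comul ResQ.counit (ResQ.Phi ε) ∧
      ¬ QB.IsQuasiTriangular ResQ.comul (ResQ.Phi ε)) ∧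
    (¬ ∃ R : ResQ.Q ⊗[ℂ] ResQ.Q, QB.IsBialgebraRMatrix ResQ.comul R) ∧
    IsEmpty (BraidedCategory (FinRep ResQ.Q)) := by
  refine ⟨fun ε hε => ?_, fun ⟨R, hR⟩ => ResQ.not_isBialgebraRMatrix R hR,
    ResQ.isEmpty_braidedCategory⟩
  have hsq : ε * ε = 1 := by rcases hε with rfl | rfl <;> simp
  exact ⟨ResQ.phi_isNormalisedThreeCocycle hsq, ResQ.Phi_eq ε, ResQ.isQuasiBialgebra hε,
    ResQ.not_isQuasiTriangular hsq⟩
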